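/- Let $\mathcal P$ be a nontrivial commutative ring with identity (for instance $\mathcal P=\mathbb Z$), let $n=2m+1\ge 7$ be odd, and let $C_n$ be the cycle with vertices $v_1,\dots,v_n$, indices being read modulo $n$. Let $L=L(C_n,X)$ be its generalized Laplacian matrix over $\mathcal P[x_1,\dots,x_n]$, that is, $L_{i,i}=x_i$, $L_{i,j}=-1$ if $v_i$ and $v_j$ are adjacent, and $L_{i,j}=0$ otherwise. Let $I_{n-1}(C_n,X)$ be the ideal of $\mathcal P[x_1,\dots,x_n]$ generated by all $(n-1)\times(n-1)$ minors of $L$. Fix any graded lexicographic order on the monomials, that is, compare total degrees first and break ties lexicographically with respect to an arbitrary total order of the variables. For $1\le i,j\le n$ let $d_{i,j}$ be the determinant of the matrix obtained from $L$ by deleting row $i$ and column $j$, and let $q_{i,j}=-d_{i,j}$ if the leading coefficient of $d_{i,j}$ is $-1$, and $q_{i,j}=d_{i,j}$ otherwise. Then the $n$ polynomials $q_{i,i+m+1}$, $1\le i\le n$, are pairwise distinct, the set $$B_1=\{q_{i,i+m+1} : 1\le i\le n\}$$ equals $\{q_{i,i+m} : 1\le i\le n\}$, and $B_1$ is a reduced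 Gröbner basis of $I_{n-1}(C_n,X)$. Explicitly: $B_1$ is a finite set of nonzero elements of $I_{n-1}(C_n,X)$; the ideal generated by the leading terms of the elements of $B_1$ equals the ideal generated by the leading terms of all elements of $I_{n-1}(C_n,X)$; every element of $B_1$ has leading coefficient $1$; and no nonzero term of an element $b\in B_1$ is divisible by the leading monomial of an element $b'\in B_1$ with $b'\ne b$. -/

import Mathlib

noncomputable section

namespace CriticalIdeals

open MvPolynomial

/-- The generalized Laplacian matrix `L(G, X)` over `R[x_u : u ∈ V]` of the digraph `G` whose
adjacency matrix is `A`: the entry `A u v` is the number of arcs from `u` to `v`. -/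
def genLaplacian {V : Type*} [DecidableEq V] (R : Type*) [CommRing R] (A : Matrix V V ℕ) :
    Matrix V V (MvPolynomial V R) :=
  Matrix.of fun u v => if u = v then X u else -(A u v : MvPolynomial V R)

/-- The set of `k`-minors of a square matrix: rows and columns are selected by the strictly
increasing maps into `Fin n`, that is, by the `k`-element sets of row and column indices. -/
def minors {S : Type*} [CommRing S] {n : ℕ} (k : ℕ) (M : Matrix (Fin n) (Fin n) S) : Set S :=
  {d | ∃ r c : Fin k ↪o Fin n, d = (M.submatrix r c).det}

/-- The `k`-th critical ideal `I_k(G, X)` of the digraph with adjacency matrix `A`. -/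
def criticalIdeal (R : Type*) [CommRing R] {n : ℕ} (A : Matrix (Fin n) (Fin n) ℕ) (k : ℕ) :
    Ideal (MvPolynomial (Fin n) R) :=
  Ideal.span (minors k (genLaplacian R A))

open Classical in
/-- The normalized minor `q_{i,j}` of `L(G, X)`: delete row `i` and column `j`, take the
determinant, and change its sign if its leading coefficient is `-1`. -/
def normMinor (R : Type*) [CommRing R] {n : ℕ} (ord : MonomialOrder (Fin (n + 1)))
    (A : Matrix (Fin (n + 1)) (Fin (n + 1)) ℕ) (i j : Fin (n + 1)) :
    MvPolynomial (Fin (n + 1)) R :=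
  let d := ((genLaplacian R A).submatrix i.succAbove j.succAbove).det
  if ord.leadingCoeff d = -1 then -d else d

/-- The graded lexicographic order attached to a linear order `lo` of the variables:
first compare total degrees, then compare lexicographically. (A variable which is smaller
in `lo` is a larger monomial.) -/
def gradedLex {σ : Type*} [Finite σ] (lo : LinearOrder σ) : MonomialOrder σ :=
  MonomialOrder.degLex

/-- `B` is a Gröbner basis of the ideal `I`: a finite set of nonzero elements of `I` whose
leading terms generate the ideal generated by the leading terms of all elements of `I`. -/
structure IsGroebnerBasis {σ R : Type*} [CommRing R] (ord : MonomialOrder σ)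
    (B : Set (MvPolynomial σ R)) (I : Ideal (MvPolynomial σ R)) : Prop where
  finite : B.Finite
  zero_notMem : (0 : MvPolynomial σ R) ∉ B
  subset : B ⊆ (I : Set (MvPolynomial σ R))
  span_leadingTerm : Ideal.span (ord.leadingTerm '' B) =
    Ideal.span (ord.leadingTerm '' (I : Set (MvPolynomial σ R)))

/-- A Gröbner basis is reduced if all leading coefficients are `1` and no nonzero term of an
element is divisible by the leading monomial of a different element. -/
structure IsReducedGroebnerBasis {σ R : Type*} [CommRing R] (ord : MonomialOrder σ)
    (B : Set (MvPolynomial σ R)) (I : Ideal (MvPolynomial σ R)) : Prop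
    extends IsGroebnerBasis ord B I where
  leadingCoeff_eq_one : ∀ b ∈ B, ord.leadingCoeff b = 1
  not_dvd : ∀ b ∈ B, ∀ b' ∈ B, b ≠ b' → ∀ e ∈ b.support,
    ¬ (monomial (ord.degree b') (1 : R) ∣ monomial e (b.coeff e))

/-- The adjacency matrix of the cycle `C_n`, with vertices the classes `0, …, n - 1` modulo `n`. -/
def cycleAdj (n : ℕ) : Matrix (Fin n) (Fin n) ℕ :=
  (SimpleGraph.cycleGraph n).adjMatrix ℕ

end CriticalIdeals

end

namespace CriticalIdeals

open MvPolynomial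

/-! ### Strict bounds on total degree. -/

section DegreeLT

variable {σ R : Type*} [CommRing R]

/-! Let `A` be the adjugate of `L`. Off the diagonal, `L * A = det L • 1` reads `x_u A_{u,j} =
A_{u-1,j} + A_{u+1,j}`. Write `p_i = A_{i+m+1,i}`, which up to sign is the minor in `B_1`. Three
facts follow from this recurrence and the symmetry of `A`.

Solving it by continuants shows that the top form of `p_i` is the single monomial `x_{i+1} ⋯
x_{i+m}` (`cycleAdjugate_sub_mem`). Hence every graded order gives the same leading monomial, with
coefficient 1.

Running it from the antipodal entries towards the diagonal shows that the `p_i` generate all entries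
of `A` (`cycleAdjugate_mem_span`).

Two instances of it lift the syzygy of adjacent leading monomials: `x_{i+1+m} p_i - x_{i+1} p_{i+1}
= p_{i+m} - p_{i+m+2}`, where the right side needs only constant coefficients
(`X_mul_antipodalMinor_sub`). Any two arcs whose monomials divide `e` are joined by a chain of
adjacent arcs doing the same, so all S-polynomials drop in degree (`sub_mem_spanLT`). A
Buchberger-style descent on the degree of the cofactors then gives `exists_arc_le`. Only monic top
monomials are ever cancelled, so `R` may have zero divisors. -/

lemma monomial_eq_smul_one (e : σ →₀ ℕ) (c : R) : monomial e c = c • monomial e (1 : R) := by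
  rw [smul_monomial, smul_eq_mul, mul_one]

/-- The polynomials of total degree less than `d`. -/
noncomputable def degreeLT (σ R : Type*) [CommRing R] (d : ℕ) : Submodule R (MvPolynomial σ R) :=
  restrictSupport R {e | e.degree < d}

lemma mem_degreeLT {d : ℕ} {f : MvPolynomial σ R} :
    f ∈ degreeLT σ R d ↔ ∀ e, f.coeff e ≠ 0 → e.degree < d := by
  simp [degreeLT, mem_restrictSupport_iff, Set.subset_def]

lemma coeff_eq_zero_of_mem_degreeLT {d : ℕ} {f : MvPolynomial σ R} (hf : f ∈ degreeLT σ R d)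
    {e : σ →₀ ℕ} (he : d ≤ e.degree) : f.coeff e = 0 := by
  by_contra h
  exact absurd (mem_degreeLT.1 hf e h) (not_lt.2 he)

lemma degreeLT_mono {a b : ℕ} (h : a ≤ b) : degreeLT σ R a ≤ degreeLT σ R b :=
  fun _ hf => mem_degreeLT.2 fun e he => (mem_degreeLT.1 hf e he).trans_le h

lemma monomial_mem_degreeLT {d : ℕ} {e : σ →₀ ℕ} (c : R) (h : e.degree < d) :
    monomial e c ∈ degreeLT σ R d := by
  classical
  refine mem_degreeLT.2 fun e' he' => ?_
  rw [coeff_monomial] at he'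
  split_ifs at he' with hh
  · exact hh ▸ h
  · exact absurd rfl he'

lemma X_mem_degreeLT (v : σ) : (X v : MvPolynomial σ R) ∈ degreeLT σ R 2 :=
  monomial_mem_degreeLT _ (by simp)

lemma C_mem_degreeLT (c : R) : (C c : MvPolynomial σ R) ∈ degreeLT σ R 1 :=
  monomial_mem_degreeLT _ (by simp)

/-- Bounds are strict, so two of them would add up with one to spare; the `b + 1` absorbs it. -/
lemma mul_mem_degreeLT {a b : ℕ} {f g : MvPolynomial σ R} (hf : f ∈ degreeLT σ R a)
    (hg : g ∈ degreeLT σ R (b + 1)) : f * g ∈ degreeLT σ R (a + b) := by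
  classical
  refine mem_degreeLT.2 fun e he => ?_
  rw [coeff_mul] at he
  obtain ⟨⟨u, v⟩, huv, hne⟩ := Finset.exists_ne_zero_of_sum_ne_zero he
  have h1 := mem_degreeLT.1 hf u (left_ne_zero_of_mul hne)
  have h2 := mem_degreeLT.1 hg v (right_ne_zero_of_mul hne)
  rw [Finset.HasAntidiagonal.mem_antidiagonal] at huv
  rw [← huv, map_add]
  dsimp only
  omega

lemma prod_mem_degreeLT {ι : Type*} (s : Finset ι) (f : ι → MvPolynomial σ R) (w : ι → ℕ)
    (h : ∀ i ∈ s, f i ∈ degreeLT σ R (w i + 1)) :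
    ∏ i ∈ s, f i ∈ degreeLT σ R (∑ i ∈ s, w i + 1) := by
  classical
  induction s using Finset.induction_on with
  | empty => simpa using C_mem_degreeLT (1 : R)
  | insert i s hi ih =>
    rw [Finset.prod_insert hi, Finset.sum_insert hi]
    have := mul_mem_degreeLT (h i (Finset.mem_insert_self i s))
      (ih fun j hj => h j (Finset.mem_insert_of_mem hj))
    exact degreeLT_mono (by omega) this

/-- A factor whose top form is a monomial may be cancelled from degree bounds. -/
lemma mem_degreeLT_of_mul_mem {d D : ℕ} {E : σ →₀ ℕ} {g h : MvPolynomial σ R}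
    (hE : E.degree = D) (hg : g - monomial E 1 ∈ degreeLT σ R D)
    (hgh : g * h ∈ degreeLT σ R (D + d)) : h ∈ degreeLT σ R d := by
  by_contra hh
  have hne : ∃ e ∈ h.support, d ≤ e.degree := by
    by_contra! hcon
    exact hh (mem_degreeLT.2 fun e he => hcon e (mem_support_iff.2 he))
  obtain ⟨e₀, he₀, hd⟩ := hne
  -- For `e` of maximal degree in `h`, the coefficient of `E + e` in `g * h` is that of `e` in `h`,
  -- since `g - monomial E 1` contributes only in smaller degrees.
  obtain ⟨e, he, hmax⟩ := h.support.exists_max_image Finsupp.degree ⟨e₀, he₀⟩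
  have h1 : h ∈ degreeLT σ R (e.degree + 1) :=
    mem_degreeLT.2 fun e' he' => Nat.lt_succ_of_le (hmax e' (mem_support_iff.2 he'))
  have h2 := coeff_eq_zero_of_mem_degreeLT (mul_mem_degreeLT hg h1) (e := E + e)
    (by rw [map_add, hE])
  have h3 := coeff_eq_zero_of_mem_degreeLT hgh (e := E + e)
    (by rw [map_add, hE]; have := hmax e₀ he₀; omega)
  rw [sub_mul, coeff_sub, h3, coeff_monomial_mul, one_mul, zero_sub, neg_eq_zero] at h2
  exact mem_support_iff.1 he h2

/-- A permutation other than the identity moves some index, so its product has a constant factor and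
misses the full degree. -/
lemma det_sub_prod_mem_degreeLT {ι : Type*} [Fintype ι] [DecidableEq ι]
    (N : Matrix ι ι (MvPolynomial σ R)) (hd : ∀ i, N i i ∈ degreeLT σ R 2)
    (ho : ∀ i j, i ≠ j → N i j ∈ degreeLT σ R 1) :
    N.det - ∏ i, N i i ∈ degreeLT σ R (Fintype.card ι) := by
  classical
  rw [Matrix.det_apply, ← Finset.add_sum_erase _ _ (Finset.mem_univ (1 : Equiv.Perm ι))]
  simp only [Equiv.Perm.sign_one, one_smul, Equiv.Perm.coe_one, id_eq, add_sub_cancel_left]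
  refine Submodule.sum_mem _ fun τ hτ => ?_
  have key : ∏ i, N (τ i) i ∈ degreeLT σ R (Fintype.card ι) := by
    have h := prod_mem_degreeLT Finset.univ (fun i => N (τ i) i)
      (fun i => if τ i = i then 1 else 0) (by
        intro i _
        by_cases hi : τ i = i
        · simpa [hi] using hd i
        · simpa [hi] using ho _ _ hi)
    refine degreeLT_mono ?_ h
    obtain ⟨i, hi⟩ : ∃ i, τ i ≠ i := by
      by_contra! hcon
      exact Finset.ne_of_mem_erase hτ (Equiv.ext hcon)
    have : ∑ i, (if τ i = i then 1 else 0) < ∑ _i : ι, 1 :=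
      Finset.sum_lt_sum (fun i _ => by split_ifs <;> simp) ⟨i, Finset.mem_univ i, by simp [hi]⟩
    simpa using this
  rcases Int.units_eq_one_or (Equiv.Perm.sign τ) with hs | hs
  · simpa [hs] using key
  · simpa [hs] using key

end DegreeLT

/-! ### Continuants and three-term recurrences. -/

section Continuant

variable {S : Type*} [CommRing S]

/-- The continuants of a sequence `y`: `continuant y (l + 1)` is the determinant of the tridiagonal
matrix with diagonal `y 0, …, y (l - 1)` and with `-1` next to the diagonal. -/
def continuant (y : ℕ → S) : ℕ → S
  | 0 => 0
  | 1 => 1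
  | l + 2 => y l * continuant y (l + 1) - continuant y l

/-- The definition expands the determinant at its last row; this is the expansion at the first. -/
lemma continuant_shift (y : ℕ → S) (k l : ℕ) :
    continuant (fun t => y (k + t)) (l + 2) =
      y k * continuant (fun t => y (k + 1 + t)) (l + 1) -
        continuant (fun t => y (k + 2 + t)) l := by
  induction l using Nat.twoStepInduction with
  | zero => simp [continuant]
  | one => simp [continuant]; ring
  | more l h1 h2 =>
    rw [continuant, h2, h1]
    have e1 := show continuant (fun t => y (k + 1 + t)) (l + 3) = y (k + (l + 2)) *
      continuant (fun t => y (k + 1 + t)) (l + 2) - continuant (fun t => y (k + 1 + t)) (l + 1) by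
        rw [continuant]; congr 3; omega
    have e2 := show continuant (fun t => y (k + 2 + t)) (l + 2) = y (k + (l + 2)) *
      continuant (fun t => y (k + 2 + t)) (l + 1) - continuant (fun t => y (k + 2 + t)) l by
        rw [continuant]; congr 3; omega
    rw [e1, e2]
    ring

lemma continuant_mul_one (y a : ℕ → S) (N : ℕ)
    (h : ∀ t < N, y t * a (t + 1) = a t + a (t + 2)) :
    continuant y (N + 1) * a 1 = a (N + 1) + continuant (fun t => y (1 + t)) N * a 0 := by
  induction N using Nat.twoStepInduction with
  | zero => simp [continuant]
  | one => simp [continuant]; linear_combination h 0 (by omega)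
  | more N h1 h2 =>
    have e1 := h1 fun t ht => h t (by omega)
    have e2 := h2 fun t ht => h t (by omega)
    have e3 := h (N + 1) (by omega)
    have e4 := show continuant (fun t => y (1 + t)) (N + 2) = y (N + 1) *
      continuant (fun t => y (1 + t)) (N + 1) - continuant (fun t => y (1 + t)) N by
        rw [continuant, add_comm 1 N]
    rw [continuant, e4]
    linear_combination y (N + 1) * e2 - e1 + e3

/-- The values of a solution of a three-term recurrence in terms of its boundary values. -/
lemma continuant_mul (y a : ℕ → S) (N : ℕ)
    (h : ∀ t < N, y t * a (t + 1) = a t + a (t + 2)) (k l : ℕ) (hk : k + l = N + 1) :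
    continuant y (N + 1) * a k =
      continuant y k * a (N + 1) + continuant (fun t => y (k + t)) l * a 0 := by
  induction k using Nat.twoStepInduction generalizing l with
  | zero => obtain rfl : l = N + 1 := by omega
            simp [continuant]
  | one => obtain rfl : l = N := by omega
           rw [continuant_mul_one y a l h]; simp [continuant]
  | more k h1 h2 =>
    have e1 := h1 (l + 2) (by omega)
    have e2 := h2 (l + 1) (by omega)
    have e3 := h k (by omega)
    rw [continuant_shift] at e1
    rw [continuant]
    linear_combination y k * e2 - e1 - continuant y (N + 1) * e3

end Continuant

lemma continuant_sub_prod_mem_degreeLT {σ R : Type*} [CommRing R] (f : ℕ → σ) (l : ℕ) :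
    continuant (fun t => (X (f t) : MvPolynomial σ R)) (l + 1) - ∏ t ∈ Finset.range l, X (f t) ∈
      degreeLT σ R l := by
  induction l using Nat.twoStepInduction with
  | zero => simp [continuant]
  | one => simp [continuant]
  | more l h1 h2 =>
    -- The subtracted continuant has degree two less than the leading product, so it only enters the
    -- error term.
    have e : continuant (fun t => (X (f t) : MvPolynomial σ R)) (l + 2 + 1) -
        ∏ t ∈ Finset.range (l + 2), X (f t) =
        (continuant (fun t => (X (f t) : MvPolynomial σ R)) (l + 1 + 1) -
          ∏ t ∈ Finset.range (l + 1), X (f t)) * X (f (l + 1)) -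
        ((continuant (fun t => (X (f t) : MvPolynomial σ R)) (l + 1) -
          ∏ t ∈ Finset.range l, X (f t)) + ∏ t ∈ Finset.range l, X (f t)) := by
      rw [Finset.prod_range_succ, continuant]
      ring
    rw [e]
    refine Submodule.sub_mem _ (mul_mem_degreeLT (b := 1) h2 (X_mem_degreeLT _)) (Submodule.add_mem _
      (degreeLT_mono (by omega) h1) (degreeLT_mono ?_ (prod_mem_degreeLT _ _ (fun _ => 1)
        fun t _ => X_mem_degreeLT _)))
    simp

section Cycle

open Fin.CommRing

section Casts

variable {n : ℕ} [NeZero n]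

lemma fin_natCast_self : ((n : ℕ) : Fin n) = 0 := by simp

lemma fin_natCast_ne_zero {t : ℕ} (h0 : 0 < t) (h : t < n) : (t : Fin n) ≠ 0 := by
  intro hh
  have := congrArg Fin.val hh
  rw [Fin.val_natCast, Nat.mod_eq_of_lt h] at this
  simp at this
  omega

lemma fin_natCast_injOn {s t : ℕ} (hs : s < n) (ht : t < n) (h : (s : Fin n) = t) : s = t := by
  have := congrArg Fin.val h
  rwa [Fin.val_natCast, Fin.val_natCast, Nat.mod_eq_of_lt hs, Nat.mod_eq_of_lt ht] at this

lemma fin_eq_add_natCast (i j : Fin n) : ∃ t < n, i = j + (t : Fin n) :=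
  ⟨(i - j).val, (i - j).isLt, by simp⟩

lemma add_natCast_ne_self (j : Fin n) {t : ℕ} (h0 : 0 < t) (h : t < n) : j + (t : Fin n) ≠ j := by
  intro hh
  exact fin_natCast_ne_zero h0 h (by simpa using hh)

end Casts

/-! ### Monomials of consecutive variables on the cycle. -/

section Arc

variable {n : ℕ} [NeZero n]

/-- The exponent of the product of the `l` consecutive variables following the index `i`. -/
noncomputable def arc (l : ℕ) (i : Fin n) : Fin n →₀ ℕ :=
  ∑ t ∈ Finset.range l, Finsupp.single (i + 1 + (t : Fin n)) 1

lemma degree_arc (l : ℕ) (i : Fin n) : (arc l i).degree = l := by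
  simp [arc]

lemma monomial_arc (R : Type*) [CommRing R] (l : ℕ) (i : Fin n) :
    (monomial (arc l i) 1 : MvPolynomial (Fin n) R) =
      ∏ t ∈ Finset.range l, X (i + 1 + (t : Fin n)) := by
  rw [arc, monomial_sum_one]
  rfl

/-- Both sides are the arc of length `l + 1` after `i`: this is the linear syzygy between adjacent
arcs. -/
lemma arc_add_single (l : ℕ) (i : Fin n) :
    arc l i + Finsupp.single (i + 1 + (l : Fin n)) 1 =
      arc l (i + 1) + Finsupp.single (i + 1) 1 := by
  rw [arc, ← Finset.sum_range_succ (fun t : ℕ => Finsupp.single (i + 1 + (t : Fin n)) 1),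
    Finset.sum_range_succ', arc]
  congr 1
  · refine Finset.sum_congr rfl fun t _ => ?_
    congr 1
    push_cast
    ring
  · simp

lemma arc_apply {l : ℕ} (hl : l ≤ n) (i v : Fin n) [Decidable (∃ t < l, v = i + 1 + (t : Fin n))] :
    arc l i v = if ∃ t < l, v = i + 1 + (t : Fin n) then 1 else 0 := by
  rw [arc, Finsupp.finsetSum_apply]
  split_ifs with h
  · obtain ⟨t, ht, rfl⟩ := h
    rw [Finset.sum_eq_single_of_mem t (Finset.mem_range.2 ht)]
    · simp
    · intro s hs hst
      refine Finsupp.single_eq_of_ne fun hh => hst ?_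
      exact (fin_natCast_injOn (by omega) (by have := Finset.mem_range.1 hs; omega)
        (add_left_cancel hh)).symm
  · refine Finset.sum_eq_zero fun t ht => Finsupp.single_eq_of_ne fun hh => ?_
    exact h ⟨t, Finset.mem_range.1 ht, hh⟩

lemma arc_le_iff {l : ℕ} (hl : l ≤ n) (i : Fin n) (e : Fin n →₀ ℕ) :
    arc l i ≤ e ↔ ∀ t < l, 1 ≤ e (i + 1 + (t : Fin n)) := by
  classical
  constructor
  · intro h t ht
    refine le_trans ?_ (h _)
    rw [arc_apply hl, if_pos ⟨t, ht, rfl⟩]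
  · intro h v
    rw [arc_apply hl]
    split_ifs with hv
    · obtain ⟨t, ht, rfl⟩ := hv
      exact h t ht
    · exact Nat.zero_le _

/-- The index `i` just before an arc is not on it, while `i + 1` is. If `i + 1` were on the arc of
`j` but not its first vertex, `i` would be on that arc too. -/
lemma arc_injective {l : ℕ} (h0 : 0 < l) (hl : l < n) :
    Function.Injective (arc l : Fin n → Fin n →₀ ℕ) := by
  classical
  intro i j hij
  have h1 := (arc_le_iff hl.le i (arc l j)).1 hij.le 0 h0
  rw [arc_apply hl.le] at h1
  split_ifs at h1 with h2
  · obtain ⟨s, hs, hsi⟩ := h2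
    rcases s with _ | s
    · simpa using hsi
    · exfalso
      have h3 := (arc_le_iff hl.le j (arc l i)).1 hij.ge s (by omega)
      have h4 : j + 1 + (s : Fin n) = i := by
        push_cast at hsi
        linear_combination -hsi
      rw [h4, arc_apply hl.le] at h3
      split_ifs at h3 with h5
      · obtain ⟨t, ht, hti⟩ := h5
        refine fin_natCast_ne_zero (n := n) (t := t + 1) (by omega) (by omega) ?_
        push_cast
        linear_combination -hti
      · omega
  · omega

end Arc

/-! ### The adjugate of the cycle Laplacian and its top forms. -/

section Adjugate

variable (R : Type*) [CommRing R]

/-- The adjugate of the generalized Laplacian matrix of the cycle. -/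
noncomputable def cycleAdjugate (n : ℕ) : Matrix (Fin n) (Fin n) (MvPolynomial (Fin n) R) :=
  (genLaplacian R (cycleAdj n)).adjugate

lemma cycleAdjugate_symm {n : ℕ} (i j : Fin n) :
    cycleAdjugate R n i j = cycleAdjugate R n j i := by
  have hT : (genLaplacian R (cycleAdj n)).transpose = genLaplacian R (cycleAdj n) := by
    ext1 u v
    simp only [Matrix.transpose_apply, genLaplacian, Matrix.of_apply, cycleAdj,
      SimpleGraph.adjMatrix_apply, SimpleGraph.adj_comm _ v u, eq_comm (a := v)]
    by_cases h : u = v <;> simp [h]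
  have := congrFun (congrFun (Matrix.adjugate_transpose (genLaplacian R (cycleAdj n))) j) i
  rwa [hT] at this

variable {n : ℕ} [NeZero n]

lemma genLaplacian_cycle_apply (hn : 3 ≤ n) (u v : Fin n) :
    genLaplacian R (cycleAdj n) u v =
      (if v = u then X u else 0) - (if v = u - 1 then 1 else 0) - (if v = u + 1 then 1 else 0) := by
  have hone : ∀ w : Fin n, w.val = 1 ↔ w = 1 := by
    intro w
    rw [Fin.ext_iff, Fin.val_one', Nat.mod_eq_of_lt (by omega)]
  have hadj : (SimpleGraph.cycleGraph n).Adj u v ↔ v = u - 1 ∨ v = u + 1 := by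
    rw [SimpleGraph.cycleGraph_adj', hone, hone, sub_eq_iff_eq_add, sub_eq_iff_eq_add,
      eq_sub_iff_add_eq, add_comm 1 v, add_comm 1 u, eq_comm (a := u)]
  have h1 := add_natCast_ne_self u (t := 1) (by omega) (by omega)
  have h2 := add_natCast_ne_self (u - 1) (t := 1) (by omega) (by omega)
  have h3 := add_natCast_ne_self (u - 1) (t := 2) (by omega) (by omega)
  rw [Nat.cast_one] at h1 h2
  have h3' : u - 1 ≠ u + 1 := by
    intro hh
    apply h3
    push_cast
    linear_combination -hh
  rw [sub_add_cancel] at h2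
  simp only [genLaplacian, Matrix.of_apply, cycleAdj, SimpleGraph.adjMatrix_apply, hadj]
  by_cases hv : v = u
  · subst hv
    simp [h1.symm, h2]
  · rw [if_neg (Ne.symm hv), if_neg hv]
    by_cases hv1 : v = u - 1
    · simp [hv1, h3']
    · by_cases hv2 : v = u + 1
      · simp [hv2, h3'.symm]
      · simp [hv1, hv2]

lemma X_mul_cycleAdjugate (hn : 3 ≤ n) {u j : Fin n} (h : u ≠ j) :
    X u * cycleAdjugate R n u j = cycleAdjugate R n (u - 1) j + cycleAdjugate R n (u + 1) j := by
  have := congrFun (congrFun (Matrix.mul_adjugate (genLaplacian R (cycleAdj n))) u) j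
  rw [Matrix.mul_apply] at this
  simp only [genLaplacian_cycle_apply R hn, sub_mul, ite_mul, one_mul, zero_mul,
    Finset.sum_sub_distrib, Finset.sum_ite_eq', Finset.mem_univ, if_true, Matrix.smul_apply,
    Matrix.one_apply_ne h, smul_zero] at this
  rw [cycleAdjugate]
  linear_combination this

end Adjugate

lemma cycleAdjugate_eq_minor (R : Type*) [CommRing R] (n : ℕ) (i j : Fin (n + 1)) :
    cycleAdjugate R (n + 1) i j = (-1) ^ (j + i : ℕ) *
      ((genLaplacian R (cycleAdj (n + 1))).submatrix j.succAbove i.succAbove).det :=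
  Matrix.adjugate_fin_succ_eq_det_submatrix _ i j

lemma cycleAdjugate_self_sub_mem (R : Type*) [CommRing R] (n : ℕ) (j : Fin (n + 1)) :
    cycleAdjugate R (n + 1) j j - monomial (arc n j) 1 ∈ degreeLT (Fin (n + 1)) R n := by
  have key := det_sub_prod_mem_degreeLT
    ((genLaplacian R (cycleAdj (n + 1))).submatrix j.succAbove j.succAbove)
    (fun i => by simpa [genLaplacian] using X_mem_degreeLT _) (fun a b hab => by
      have h : j.succAbove a ≠ j.succAbove b := fun hh => hab (Fin.succAbove_right_injective hh)
      simp only [Matrix.submatrix_apply, genLaplacian, Matrix.of_apply, if_neg h]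
      have hC := C_mem_degreeLT (σ := Fin (n + 1))
        ((cycleAdj (n + 1) (j.succAbove a) (j.succAbove b) : ℕ) : R)
      exact Submodule.neg_mem _ (by simpa using hC))
  have hprod : (monomial (arc n j) 1 : MvPolynomial (Fin (n + 1)) R) =
      ∏ i, (X (j.succAbove i)) := by
    have e1 : (∏ i, X (j.succAbove i) : MvPolynomial (Fin (n + 1)) R) =
        ∏ v ∈ Finset.univ.erase j, X v := by
      rw [← Finset.compl_singleton, ← Fin.image_succAbove_univ,
        Finset.prod_image (Fin.succAbove_right_injective.injOn)]
    have hinj : Set.InjOn (fun t : ℕ => j + 1 + (t : Fin (n + 1))) (Finset.range n) := by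
      intro s hs t ht hst
      simp only [Finset.coe_range, Set.mem_Iio] at hs ht
      exact fin_natCast_injOn (n := n + 1) (by omega) (by omega) (add_left_cancel hst)
    have e2 : (Finset.range n).image (fun t : ℕ => j + 1 + (t : Fin (n + 1))) =
        Finset.univ.erase j := by
      refine Finset.eq_of_subset_of_card_le ?_ ?_
      · intro v hv
        obtain ⟨t, ht, rfl⟩ := Finset.mem_image.1 hv
        have := add_natCast_ne_self j (t := t + 1) (by omega)
          (by have := Finset.mem_range.1 ht; omega)
        rw [Nat.cast_succ, add_comm (t : Fin (n + 1)), ← add_assoc] at this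
        exact Finset.mem_erase.2 ⟨this, Finset.mem_univ _⟩
      · rw [Finset.card_image_of_injOn hinj]
        simp
    rw [monomial_arc, e1, ← e2, Finset.prod_image hinj]
  rw [cycleAdjugate_eq_minor, Even.neg_one_pow (Even.add_self _), one_mul, hprod]
  simpa [genLaplacian] using key

/-- The top form of the entry of the adjugate at distance `k + 1` on one side and `l + 1` on the
other, if `l < k`. -/
lemma cycleAdjugate_sub_mem (R : Type*) [CommRing R] {n k l : ℕ} (hn : 2 ≤ n) (hkl : l < k)
    (h : k + l + 1 = n) (j : Fin (n + 1)) :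
    cycleAdjugate R (n + 1) (j + (k + 1 : ℕ)) j - monomial (arc k j) 1 ∈
      degreeLT (Fin (n + 1)) R k := by
  set f : ℕ → Fin (n + 1) := fun t => j + 1 + (t : Fin (n + 1)) with hf
  set y : ℕ → MvPolynomial (Fin (n + 1)) R := fun t => X (f t) with hy
  set a : ℕ → MvPolynomial (Fin (n + 1)) R :=
    fun t => cycleAdjugate R (n + 1) (j + (t : Fin (n + 1))) j with ha
  have hrec : ∀ t < n, y t * a (t + 1) = a t + a (t + 2) := by
    intro t ht
    have := X_mul_cycleAdjugate R (n := n + 1) (by omega)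
      (add_natCast_ne_self j (t := t + 1) (by omega) (by omega))
    simp only [ha, hy, hf]
    rw [show j + ((t + 1 : ℕ) : Fin (n + 1)) - 1 = j + t by push_cast; ring,
      show j + ((t + 1 : ℕ) : Fin (n + 1)) + 1 = j + (t + 2 : ℕ) by push_cast; ring,
      show j + ((t + 1 : ℕ) : Fin (n + 1)) = j + 1 + t by push_cast; ring] at this
    rw [show j + ((t + 1 : ℕ) : Fin (n + 1)) = j + 1 + t by push_cast; ring]
    exact this
  -- Both boundary values `a 0` and `a (n + 1)` are the diagonal entry, because the walk closes up.
  -- Thus `continuant y (n + 1) * a (k + 1) = c * a 0` for the `c` below, and the outer factors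
  -- share their top monomial.
  have hdir := continuant_mul y a n hrec (k + 1) (l + 1) (by omega)
  have ha0 : a 0 = cycleAdjugate R (n + 1) j j := by simp [ha]
  have han : a (n + 1) = a 0 := by
    simp only [ha]
    rw [fin_natCast_self, Nat.cast_zero]
  have hP := continuant_sub_prod_mem_degreeLT (R := R) f n
  have hK := continuant_sub_prod_mem_degreeLT (R := R) f k
  have hL := continuant_sub_prod_mem_degreeLT (R := R) (fun t => f (k + 1 + t)) l
  have hself := cycleAdjugate_self_sub_mem R n j
  rw [← monomial_arc] at hP hK
  change continuant y (n + 1) - _ ∈ _ at hP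
  change continuant y (k + 1) - _ ∈ _ at hK
  change continuant (fun t => y (k + 1 + t)) (l + 1) - _ ∈ _ at hL
  rw [← ha0] at hself
  -- Here `l < k` matters: the shorter side of the cycle does not reach the top form.
  have hL' : continuant (fun t => y (k + 1 + t)) (l + 1) ∈ degreeLT (Fin (n + 1)) R k := by
    have h1 := Submodule.add_mem _ (degreeLT_mono (Nat.le_succ l) hL) (degreeLT_mono (b := l + 1)
      (by simp) (prod_mem_degreeLT (R := R) (Finset.range l)
        (fun t => X (f (k + 1 + t))) (fun _ => 1) fun t _ => X_mem_degreeLT _))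
    rw [sub_add_cancel] at h1
    exact degreeLT_mono hkl h1
  set c := continuant y (k + 1) + continuant (fun t => y (k + 1 + t)) (l + 1) with hc
  have hcsub : c - monomial (arc k j) 1 ∈ degreeLT (Fin (n + 1)) R k := by
    rw [show c - monomial (arc k j) 1 = (continuant y (k + 1) - monomial (arc k j) 1) +
      continuant (fun t => y (k + 1 + t)) (l + 1) by rw [hc]; ring]
    exact Submodule.add_mem _ hK hL'
  have hcmem : c ∈ degreeLT (Fin (n + 1)) R (k + 1) := by
    have := Submodule.add_mem _ (degreeLT_mono (Nat.le_succ k) hcsub)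
      (monomial_mem_degreeLT (1 : R) ((degree_arc k j).trans_lt (Nat.lt_succ_self k)))
    rwa [sub_add_cancel] at this
  have hdiff : a 0 - continuant y (n + 1) ∈ degreeLT (Fin (n + 1)) R n := by
    have := Submodule.sub_mem _ hself hP
    rwa [sub_sub_sub_cancel_right] at this
  have hmain : a (k + 1) - c ∈ degreeLT (Fin (n + 1)) R k := by
    refine mem_degreeLT_of_mul_mem (degree_arc n j) hP ?_
    rw [show continuant y (n + 1) * (a (k + 1) - c) = (a 0 - continuant y (n + 1)) * c by
      rw [mul_sub, hdir, han, hc]; ring]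
    exact mul_mem_degreeLT hdiff hcmem
  have := Submodule.add_mem _ hmain hcsub
  rwa [sub_add_sub_cancel] at this

end Cycle

/-! ### The antipodal minors as a Gröbner basis. -/

section Groebner

open Fin.CommRing

section OddCycle

variable (R : Type*) [CommRing R] (m : ℕ)

/-- The entries of the adjugate at the positions where the two distances in the cycle of odd length
`2 * m + 1` are as equal as possible. -/
noncomputable def antipodalMinor (i : Fin (2 * m + 1)) : MvPolynomial (Fin (2 * m + 1)) R :=
  cycleAdjugate R (2 * m + 1) (i + ((m + 1 : ℕ) : Fin (2 * m + 1))) i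

variable {m}

lemma two_mul_natCast_add_one : 2 * (m : Fin (2 * m + 1)) + 1 = 0 := by
  have := fin_natCast_self (n := 2 * m + 1)
  push_cast at this
  exact this

lemma antipodalMinor_sub_mem (hm : 3 ≤ m) (i : Fin (2 * m + 1)) :
    antipodalMinor R m i - monomial (arc m i) 1 ∈ degreeLT (Fin (2 * m + 1)) R m :=
  cycleAdjugate_sub_mem R (l := m - 1) (by omega) (by omega) (by omega) i

lemma antipodalMinor_mem (hm : 3 ≤ m) (i : Fin (2 * m + 1)) :
    antipodalMinor R m i ∈ degreeLT (Fin (2 * m + 1)) R (m + 1) := by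
  have := Submodule.add_mem _ (degreeLT_mono (Nat.le_succ m) (antipodalMinor_sub_mem R hm i))
    (monomial_mem_degreeLT (1 : R) ((degree_arc m i).trans_lt (Nat.lt_succ_self m)))
  rwa [sub_add_cancel] at this

/-- By symmetry, distance `m` one way round is distance `m + 1` the other way. -/
lemma cycleAdjugate_add_natCast (j : Fin (2 * m + 1)) :
    cycleAdjugate R (2 * m + 1) (j + (m : Fin (2 * m + 1))) j =
      antipodalMinor R m (j + (m : Fin (2 * m + 1))) := by
  rw [antipodalMinor, cycleAdjugate_symm]
  congr 1
  push_cast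
  linear_combination -(two_mul_natCast_add_one (m := m))

/-- The linear syzygies of the leading monomials lift. -/
lemma X_mul_antipodalMinor_sub (hm : 3 ≤ m) (i : Fin (2 * m + 1)) :
    X (i + 1 + (m : Fin (2 * m + 1))) * antipodalMinor R m i -
        X (i + 1) * antipodalMinor R m (i + 1) =
      antipodalMinor R m (i + (m : Fin (2 * m + 1))) -
        antipodalMinor R m (i + (m : Fin (2 * m + 1)) + 2) := by
  have h0 := two_mul_natCast_add_one (m := m)
  -- The recurrence in column `i` at row `i + m + 1` and the one in column `i + m + 2` at row `i +
  -- 1` share the entry joining `i` and `i + m + 2`, which cancels.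
  have h1 := X_mul_cycleAdjugate R (n := 2 * m + 1) (by omega)
    (add_natCast_ne_self i (t := m + 1) (by omega) (by omega))
  have h2 := X_mul_cycleAdjugate R (n := 2 * m + 1) (by omega)
    (add_natCast_ne_self (i + 1) (t := m + 1) (by omega) (by omega)).symm
  rw [show i + ((m + 1 : ℕ) : Fin (2 * m + 1)) - 1 = i + m by push_cast; ring,
    show i + ((m + 1 : ℕ) : Fin (2 * m + 1)) + 1 = i + m + 2 by push_cast; ring,
    cycleAdjugate_add_natCast] at h1
  rw [show i + 1 + ((m + 1 : ℕ) : Fin (2 * m + 1)) = i + m + 2 by push_cast; ring,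
    add_sub_cancel_right, cycleAdjugate_symm R (i + 1) (i + (m : Fin (2 * m + 1)) + 2), cycleAdjugate_symm R i] at h2
  have h3 : cycleAdjugate R (2 * m + 1) (i + 1 + 1) (i + m + 2) =
      antipodalMinor R m (i + m + 2) := by
    rw [antipodalMinor]
    congr 1
    push_cast
    linear_combination -h0
  have h4 : antipodalMinor R m i =
    cycleAdjugate R (2 * m + 1) (i + ((m + 1 : ℕ) : Fin (2 * m + 1))) i := rfl
  have h5 : antipodalMinor R m (i + 1) = cycleAdjugate R (2 * m + 1) (i + m + 2) (i + 1) := by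
    rw [antipodalMinor]
    congr 1
    push_cast
    ring
  rw [show i + ((m + 1 : ℕ) : Fin (2 * m + 1)) = i + 1 + m by push_cast; ring] at h1 h4
  rw [h3] at h2
  rw [h4, h5]
  linear_combination h1 - h2

lemma cycleAdjugate_mem_span (hm : 3 ≤ m) (i j : Fin (2 * m + 1)) :
    cycleAdjugate R (2 * m + 1) i j ∈ Ideal.span (Set.range (antipodalMinor R m)) := by
  have hgen : ∀ i, antipodalMinor R m i ∈ Ideal.span (Set.range (antipodalMinor R m)) :=
    fun i => Ideal.subset_span ⟨i, rfl⟩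
  -- Offsets `m` and `m + 1` are generators; the recurrence carries membership on to offset `2 * m +
  -- 1`, the diagonal. Symmetry gives the offsets below `m`.
  have key : ∀ (j : Fin (2 * m + 1)) (t : ℕ), t ≤ m + 1 →
      cycleAdjugate R (2 * m + 1) (j + ((m + t : ℕ) : Fin (2 * m + 1))) j ∈
        Ideal.span (Set.range (antipodalMinor R m)) := by
    intro j t
    induction t using Nat.twoStepInduction with
    | zero =>
      intro _
      rw [add_zero, cycleAdjugate_add_natCast]
      exact hgen _
    | one => exact fun _ => hgen j
    | more t h1 h2 =>
      intro ht
      have e := X_mul_cycleAdjugate R (n := 2 * m + 1) (by omega)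
        (add_natCast_ne_self j (t := m + (t + 1)) (by omega) (by omega))
      rw [show j + ((m + (t + 1) : ℕ) : Fin (2 * m + 1)) - 1 = j + (m + t : ℕ) by
          push_cast; ring,
        show j + ((m + (t + 1) : ℕ) : Fin (2 * m + 1)) + 1 = j + (m + (t + 2) : ℕ) by
          push_cast; ring, ← sub_eq_iff_eq_add'] at e
      rw [← e]
      exact Ideal.sub_mem _ (Ideal.mul_mem_left _ _ (h2 (by omega))) (h1 (by omega))
  obtain ⟨t, ht, rfl⟩ := fin_eq_add_natCast i j
  by_cases h : m ≤ t
  · obtain ⟨s, rfl⟩ := Nat.exists_eq_add_of_le h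
    exact key j s (by omega)
  · have e := key (j + (t : Fin (2 * m + 1))) (m + 1 - t) (by omega)
    rw [show m + (m + 1 - t) = 2 * m + 1 - t by omega, Nat.cast_sub (by omega), fin_natCast_self,
      zero_sub, add_neg_cancel_right] at e
    rwa [cycleAdjugate_symm]

/-- The polynomials which are combinations of multiples of the antipodal minors by monomials of
degree less than `d`. -/
noncomputable def spanLT (m d : ℕ) : Submodule R (MvPolynomial (Fin (2 * m + 1)) R) :=
  Submodule.span R {f | ∃ b i, b.degree < d ∧ f = monomial b 1 * antipodalMinor R m i}

lemma monomial_mul_mem_spanLT {d : ℕ} {b : Fin (2 * m + 1) →₀ ℕ} (h : b.degree < d)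
    (i : Fin (2 * m + 1)) : monomial b 1 * antipodalMinor R m i ∈ spanLT R m d :=
  Submodule.subset_span ⟨b, i, h, rfl⟩

lemma mul_antipodalMinor_mem_spanLT {d : ℕ} {g : MvPolynomial (Fin (2 * m + 1)) R}
    (hg : g ∈ degreeLT _ R d) (i : Fin (2 * m + 1)) :
    g * antipodalMinor R m i ∈ spanLT R m d := by
  rw [g.as_sum, Finset.sum_mul]
  refine Submodule.sum_mem _ fun e he => ?_
  rw [monomial_eq_smul_one, smul_mul_assoc]
  exact Submodule.smul_mem _ _
    (monomial_mul_mem_spanLT R (mem_degreeLT.1 hg e (mem_support_iff.1 he)) i)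

lemma exists_mem_spanLT {f : MvPolynomial (Fin (2 * m + 1)) R}
    (hf : f ∈ Ideal.span (Set.range (antipodalMinor R m))) : ∃ d, f ∈ spanLT R m d := by
  obtain ⟨c, rfl⟩ := Ideal.mem_span_range_iff_exists_fun.1 hf
  refine ⟨∑ i, ((c i).totalDegree + 1), Submodule.sum_mem _ fun i _ => ?_⟩
  refine mul_antipodalMinor_mem_spanLT R (mem_degreeLT.2 fun e he => ?_) i
  refine (Nat.lt_succ_of_le ?_).trans_le (Finset.single_le_sum
    (f := fun i => (c i).totalDegree + 1) (fun _ _ => Nat.zero_le _) (Finset.mem_univ i))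
  exact le_totalDegree (mem_support_iff.2 he)

/-- Two adjacent arcs below `e` make up an arc of length `m + 1` below `e`, so the difference is a
monomial multiple of the lifted linear syzygy, with cofactors one degree smaller. -/
lemma adjacent_sub_mem_spanLT (hm : 3 ≤ m) {e : Fin (2 * m + 1) →₀ ℕ} {i : Fin (2 * m + 1)}
    (h1 : arc m i ≤ e) (h2 : arc m (i + 1) ≤ e) :
    monomial (e - arc m i) 1 * antipodalMinor R m i -
        monomial (e - arc m (i + 1)) 1 * antipodalMinor R m (i + 1) ∈
      spanLT R m (e.degree - m) := by
  have hle : arc m i + Finsupp.single (i + 1 + (m : Fin (2 * m + 1))) 1 ≤ e := by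
    rw [show arc m i + Finsupp.single (i + 1 + (m : Fin (2 * m + 1))) 1 = arc (m + 1) i by
      rw [arc, arc, Finset.sum_range_succ], arc_le_iff (by omega)]
    intro t ht
    rcases Nat.lt_succ_iff_lt_or_eq.1 ht with h | rfl
    · exact (arc_le_iff (by omega) i e).1 h1 t h
    · have := (arc_le_iff (by omega) (i + 1) e).1 h2 (t - 1) (by omega)
      rwa [Nat.cast_sub (by omega), Nat.cast_one, show i + 1 + 1 + ((t : Fin (2 * t + 1)) - 1) =
        i + 1 + t by ring] at this
  obtain ⟨b, rfl⟩ := exists_add_of_le hle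
  have e1 : arc m i + Finsupp.single (i + 1 + (m : Fin (2 * m + 1))) 1 + b - arc m i =
      b + Finsupp.single (i + 1 + (m : Fin (2 * m + 1))) 1 := by
    rw [add_assoc, add_tsub_cancel_left, add_comm b]
  have e2 : arc m i + Finsupp.single (i + 1 + (m : Fin (2 * m + 1))) 1 + b - arc m (i + 1) =
      b + Finsupp.single (i + 1) 1 := by
    rw [arc_add_single, add_assoc, add_tsub_cancel_left, add_comm b]
  have e3 : ∀ v, (monomial (b + Finsupp.single v 1) 1 : MvPolynomial (Fin (2 * m + 1)) R) =
      monomial b 1 * X v := by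
    intro v
    rw [X, monomial_mul, one_mul]
  have hb : b.degree <
      (arc m i + Finsupp.single (i + 1 + (m : Fin (2 * m + 1))) 1 + b).degree - m := by
    rw [map_add, map_add, degree_arc, Finsupp.degree_single]
    omega
  rw [e1, e2, e3, e3, mul_assoc, mul_assoc, ← mul_sub, X_mul_antipodalMinor_sub R hm, mul_sub]
  exact Submodule.sub_mem _ (monomial_mul_mem_spanLT R hb _) (monomial_mul_mem_spanLT R hb _)

lemma sub_mem_spanLT (hm : 3 ≤ m) {e : Fin (2 * m + 1) →₀ ℕ} {i j : Fin (2 * m + 1)}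
    (h1 : arc m i ≤ e) (h2 : arc m j ≤ e) :
    monomial (e - arc m i) 1 * antipodalMinor R m i -
        monomial (e - arc m j) 1 * antipodalMinor R m j ∈ spanLT R m (e.degree - m) := by
  -- For `t ≤ m` the end arcs leave no gap, so every arc in between lies in their union and the
  -- differences telescope. One of the two ways round the cycle has at most `m` steps.
  have key : ∀ (t : ℕ) (i : Fin (2 * m + 1)), t ≤ m → arc m i ≤ e →
      arc m (i + (t : Fin (2 * m + 1))) ≤ e →
      monomial (e - arc m i) 1 * antipodalMinor R m i -
        monomial (e - arc m (i + (t : Fin (2 * m + 1)))) 1 *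
          antipodalMinor R m (i + (t : Fin (2 * m + 1))) ∈ spanLT R m (e.degree - m) := by
    intro t
    induction t with
    | zero => intro i _ _ _; simp
    | succ t ih =>
      intro i ht hi hit
      have hi1 : arc m (i + 1) ≤ e := by
        rw [arc_le_iff (by omega)] at hi hit ⊢
        intro s hs
        by_cases h : s + 1 < m
        · have := hi (s + 1) h
          rwa [show i + 1 + ((s + 1 : ℕ) : Fin (2 * m + 1)) = i + 1 + 1 + s by
            push_cast; ring] at this
        · have := hit (s - t) (by omega)
          rwa [Nat.cast_sub (by omega), show i + ((t + 1 : ℕ) : Fin (2 * m + 1)) + 1 + (s - t) =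
            i + 1 + 1 + s by push_cast; ring] at this
      have e1 : i + ((t + 1 : ℕ) : Fin (2 * m + 1)) = i + 1 + t := by push_cast; ring
      rw [e1] at hit ⊢
      have := Submodule.add_mem _ (adjacent_sub_mem_spanLT R hm hi hi1)
        (ih (i + 1) (by omega) hi1 hit)
      rwa [sub_add_sub_cancel] at this
  obtain ⟨t, ht, rfl⟩ := fin_eq_add_natCast i j
  by_cases h : t ≤ m
  · rw [← Submodule.neg_mem_iff, neg_sub]
    exact key t j h h2 h1
  · have e1 : j = j + (t : Fin (2 * m + 1)) + ((2 * m + 1 - t : ℕ) : Fin (2 * m + 1)) := by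
      rw [Nat.cast_sub (by omega), fin_natCast_self]
      ring
    have := key (2 * m + 1 - t) (j + (t : Fin (2 * m + 1))) (by omega) h1 (e1 ▸ h2)
    rwa [← e1] at this

open Classical in
/-- Replace each monomial of degree `d` divisible by the leading monomial of an antipodal minor by
a multiple of such a minor, and drop the others. -/
noncomputable def lift (m d : ℕ) :
    MvPolynomial (Fin (2 * m + 1)) R →ₗ[R] MvPolynomial (Fin (2 * m + 1)) R :=
  (basisMonomials (Fin (2 * m + 1)) R).constr R fun e =>
    if h : e.degree = d ∧ ∃ i, arc m i ≤ e then
      monomial (e - arc m h.2.choose) 1 * antipodalMinor R m h.2.choose else 0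

open Classical in
lemma lift_monomial (d : ℕ) (e : Fin (2 * m + 1) →₀ ℕ) :
    lift R m d (monomial e 1) = if h : e.degree = d ∧ ∃ i, arc m i ≤ e then
      monomial (e - arc m h.2.choose) 1 * antipodalMinor R m h.2.choose else 0 :=
  (basisMonomials (Fin (2 * m + 1)) R).constr_basis R _ e

lemma lift_eq_zero {d : ℕ} {f : MvPolynomial (Fin (2 * m + 1)) R} (hf : f ∈ degreeLT _ R d) :
    lift R m d f = 0 := by
  rw [f.as_sum, map_sum]
  refine Finset.sum_eq_zero fun e he => ?_
  have hd := mem_degreeLT.1 hf e (mem_support_iff.1 he)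
  rw [monomial_eq_smul_one, map_smul, lift_monomial, dif_neg (fun h => hd.ne h.1), smul_zero]

/-- The arc chosen in `lift` is arbitrary; `sub_mem_spanLT` makes the choice harmless modulo smaller
cofactors. -/
lemma lift_monomial_sub_mem (hm : 3 ≤ m) (b : Fin (2 * m + 1) →₀ ℕ) (i : Fin (2 * m + 1)) :
    lift R m (b.degree + m) (monomial (b + arc m i) 1) -
      monomial b 1 * antipodalMinor R m i ∈ spanLT R m b.degree := by
  have hle : arc m i ≤ b + arc m i := le_add_self
  have h : (b + arc m i).degree = b.degree + m ∧ ∃ j, arc m j ≤ b + arc m i :=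
    ⟨by rw [map_add, degree_arc], i, hle⟩
  have := sub_mem_spanLT R hm h.2.choose_spec hle
  have hdeg : (b + arc m i).degree - m = b.degree := by rw [h.1, Nat.add_sub_cancel]
  rw [hdeg, add_tsub_cancel_right] at this
  rw [lift_monomial, dif_pos h]
  exact this

lemma monomial_mul_sub_mem_degreeLT (hm : 3 ≤ m) (b : Fin (2 * m + 1) →₀ ℕ)
    (i : Fin (2 * m + 1)) :
    monomial b 1 * antipodalMinor R m i - monomial (b + arc m i) 1 ∈
      degreeLT _ R (b.degree + m) := by
  have := mul_mem_degreeLT (antipodalMinor_sub_mem R hm i)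
    (monomial_mem_degreeLT (1 : R) (Nat.lt_succ_self b.degree))
  rwa [sub_mul, monomial_mul, one_mul, mul_comm (antipodalMinor R m i), add_comm (arc m i),
    add_comm m b.degree] at this

/-- The descent step: if `f` has degree less than `d + m`, then `lift` kills it, and `f` itself can
be written with smaller cofactors. -/
lemma sub_lift_mem_spanLT (hm : 3 ≤ m) {d : ℕ} {f : MvPolynomial (Fin (2 * m + 1)) R}
    (hf : f ∈ spanLT R m (d + 1)) : f - lift R m (d + m) f ∈ spanLT R m d := by
  suffices spanLT R m (d + 1) ≤ (spanLT R m d).comap (LinearMap.id - lift R m (d + m)) from this hf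
  refine Submodule.span_le.2 ?_
  rintro _ ⟨b, i, hb, rfl⟩
  simp only [Submodule.comap_coe, Set.mem_preimage, LinearMap.sub_apply, LinearMap.id_apply,
    SetLike.mem_coe]
  have h1 := monomial_mul_sub_mem_degreeLT R hm b i
  rcases Nat.lt_succ_iff_lt_or_eq.1 hb with h | rfl
  · rw [lift_eq_zero R, sub_zero]
    · exact monomial_mul_mem_spanLT R h i
    · have := mul_mem_degreeLT (monomial_mem_degreeLT (1 : R) (Nat.lt_succ_self b.degree))
        (antipodalMinor_mem R hm i)
      exact degreeLT_mono (by omega) this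
  · have h2 := lift_eq_zero R h1
    rw [map_sub, sub_eq_zero] at h2
    rw [h2, ← Submodule.neg_mem_iff, neg_sub]
    exact lift_monomial_sub_mem R hm b i

lemma spanLT_le_restrictSupport (hm : 3 ≤ m) (d : ℕ) :
    spanLT R m (d + 1) ≤ restrictSupport R {e | e.degree < d + m ∨ ∃ i, arc m i ≤ e} := by
  refine Submodule.span_le.2 ?_
  rintro _ ⟨b, i, hb, rfl⟩
  rw [SetLike.mem_coe, ← sub_add_cancel (monomial b 1 * antipodalMinor R m i)
    (monomial (b + arc m i) 1)]
  refine Submodule.add_mem _ (restrictSupport_mono R (fun e he => Or.inl ?_)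
    (monomial_mul_sub_mem_degreeLT R hm b i))
    ((monomial_mem_restrictSupport R).2 (Or.inl (Or.inr ⟨i, le_add_self⟩)))
  simp only [Set.mem_ofPred_eq] at he
  omega

/-- The monomials of largest degree: those of a nonzero element of the ideal generated by the
antipodal minors are divisible by a leading monomial of such a minor. -/
lemma exists_arc_le (hm : 3 ≤ m) {f : MvPolynomial (Fin (2 * m + 1)) R}
    (hf : f ∈ Ideal.span (Set.range (antipodalMinor R m))) {e : Fin (2 * m + 1) →₀ ℕ}
    (he : e ∈ f.support) (hmax : ∀ e' ∈ f.support, e'.degree ≤ e.degree) :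
    ∃ i, arc m i ≤ e := by
  obtain ⟨d, hd⟩ := exists_mem_spanLT R hf
  induction d with
  | zero =>
    have h0 : spanLT R m 0 = ⊥ := by
      refine Submodule.span_eq_bot.2 ?_
      rintro _ ⟨b, i, hb, _⟩
      exact absurd hb (Nat.not_lt_zero _)
    rw [h0, Submodule.mem_bot] at hd
    simp [hd] at he
  | succ d ih =>
    -- Either `e` is already divisible by a leading monomial, or all of `f` lies below degree `d +
    -- m` and the cofactor bound can be lowered.
    rcases spanLT_le_restrictSupport R hm d hd he with h | h
    · refine ih ?_
      have hlt : f ∈ degreeLT _ R (d + m) := mem_degreeLT.2 fun e' he' =>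
        (hmax e' (mem_support_iff.2 he')).trans_lt h
      have := sub_lift_mem_spanLT R hm hd
      rwa [lift_eq_zero R hlt, sub_zero] at this
    · exact h

lemma exists_orderEmb_eq_succAbove {n : ℕ} (r : Fin n ↪o Fin (n + 1)) :
    ∃ i : Fin (n + 1), (r : Fin n → Fin (n + 1)) = i.succAbove := by
  classical
  have hcard : (Finset.univ.image r)ᶜ.card = 1 := by
    rw [Finset.card_compl, Finset.card_image_of_injective _ r.injective]
    simp
  obtain ⟨i, hi⟩ := Finset.card_eq_one.1 hcard
  refine ⟨i, ?_⟩
  have hrange : Set.range r = Set.range i.succAboveOrderEmb := by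
    rw [Fin.range_succAboveOrderEmb]
    ext v
    have : v ∈ (Finset.univ.image r)ᶜ ↔ v ∈ ({i} : Finset _) := by rw [hi]
    simp only [Finset.mem_compl, Finset.mem_image, Finset.mem_univ, true_and,
      Finset.mem_singleton] at this
    rw [Set.mem_compl_iff, Set.mem_singleton_iff, ← this, not_not, Set.mem_range]
  exact congrArg DFunLike.coe (OrderEmbedding.range_inj.1 hrange)

lemma minor_eq_cycleAdjugate (n : ℕ) (i j : Fin (n + 1)) :
    ((genLaplacian R (cycleAdj (n + 1))).submatrix i.succAbove j.succAbove).det =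
      (-1) ^ (i + j : ℕ) * cycleAdjugate R (n + 1) j i := by
  rw [cycleAdjugate_eq_minor, ← mul_assoc, ← mul_pow]
  simp

lemma criticalIdeal_eq_span (hm : 3 ≤ m) :
    criticalIdeal R (cycleAdj (2 * m + 1)) (2 * m) =
      Ideal.span (Set.range (antipodalMinor R m)) := by
  refine le_antisymm (Ideal.span_le.2 ?_) (Ideal.span_le.2 ?_)
  · rintro _ ⟨r, c, rfl⟩
    obtain ⟨i, hi⟩ := exists_orderEmb_eq_succAbove r
    obtain ⟨j, hj⟩ := exists_orderEmb_eq_succAbove c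
    rw [hi, hj, minor_eq_cycleAdjugate]
    exact Ideal.mul_mem_left _ _ (cycleAdjugate_mem_span R hm j i)
  · rintro _ ⟨i, rfl⟩
    rw [antipodalMinor, cycleAdjugate_eq_minor]
    exact Ideal.mul_mem_left _ _ (Ideal.subset_span
      ⟨Fin.succAboveOrderEmb _, Fin.succAboveOrderEmb _, rfl⟩)

end OddCycle

/-! ### Leading terms for graded orders and normalized minors. -/

section Order

variable {σ R : Type*} [CommRing R] [Finite σ] (lo : LinearOrder σ)

lemma degree_le_degree_gradedLex {f : MvPolynomial σ R} {e : σ →₀ ℕ} (he : e ∈ f.support) :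
    e.degree ≤ ((gradedLex lo).degree f).degree := by
  have h := (gradedLex lo).le_degree he
  exact Finsupp.DegLex.monotone_degree h

/-- The top form is one monomial, so ties are never broken and `lo` plays no role. -/
lemma degree_eq_of_sub_monomial_mem [Nontrivial R] {f : MvPolynomial σ R} {E : σ →₀ ℕ} {d : ℕ}
    (hE : E.degree = d) (hf : f - monomial E 1 ∈ degreeLT σ R d) :
    (gradedLex lo).degree f = E ∧ (gradedLex lo).leadingCoeff f = 1 := by
  classical
  have hcoeff : ∀ e, d ≤ e.degree → f.coeff e = if E = e then 1 else 0 := by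
    intro e he
    have := coeff_eq_zero_of_mem_degreeLT hf he
    rwa [coeff_sub, coeff_monomial, sub_eq_zero] at this
  have hEs : E ∈ f.support := by
    rw [mem_support_iff, hcoeff E hE.ge, if_pos rfl]
    exact one_ne_zero
  have hdeg := degree_le_degree_gradedLex lo hEs
  have hne : f ≠ 0 := by
    rintro rfl
    simp at hEs
  have hmem := mem_support_iff.1 ((gradedLex lo).degree_mem_support hne)
  rw [hcoeff _ (hE ▸ hdeg)] at hmem
  have heq : (gradedLex lo).degree f = E := by
    by_contra hh
    rw [if_neg (Ne.symm hh)] at hmem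
    exact hmem rfl
  refine ⟨heq, ?_⟩
  rw [MonomialOrder.leadingCoeff, heq, hcoeff E hE.ge, if_pos rfl]

end Order

lemma normMinor_cycleAdj (R : Type*) [CommRing R] {n : ℕ} (ord : MonomialOrder (Fin (n + 1)))
    (i j : Fin (n + 1)) (h : ord.leadingCoeff (cycleAdjugate R (n + 1) j i) = 1) :
    normMinor R ord (cycleAdj (n + 1)) i j = cycleAdjugate R (n + 1) j i := by
  rw [normMinor, minor_eq_cycleAdjugate]
  rcases neg_one_pow_eq_or (MvPolynomial (Fin (n + 1)) R) (i + j : ℕ) with hs | hs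
  · rw [hs, one_mul]
    split_ifs with h1
    -- This case means `1 = -1` in `R`, where the change of sign has no effect.
    · rw [h] at h1
      have h2 : (1 : MvPolynomial (Fin (n + 1)) R) = -1 := by
        simpa using congrArg (C (σ := Fin (n + 1))) h1
      rw [neg_eq_neg_one_mul, ← h2, one_mul]
    · rfl
  · rw [hs, neg_one_mul, MonomialOrder.leadingCoeff_neg, h, if_pos rfl, neg_neg]

section

variable (R : Type*) [CommRing R] [Nontrivial R] {m : ℕ} (lo : LinearOrder (Fin (2 * m + 1)))

lemma degree_antipodalMinor (hm : 3 ≤ m) (i : Fin (2 * m + 1)) :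
    (gradedLex lo).degree (antipodalMinor R m i) = arc m i :=
  (degree_eq_of_sub_monomial_mem lo (degree_arc m i) (antipodalMinor_sub_mem R hm i)).1

lemma leadingCoeff_antipodalMinor (hm : 3 ≤ m) (i : Fin (2 * m + 1)) :
    (gradedLex lo).leadingCoeff (antipodalMinor R m i) = 1 :=
  (degree_eq_of_sub_monomial_mem lo (degree_arc m i) (antipodalMinor_sub_mem R hm i)).2

lemma normMinor_succ (hm : 3 ≤ m) (i : Fin (2 * m + 1)) :
    normMinor R (gradedLex lo) (cycleAdj (2 * m + 1)) i
      (i + ((m + 1 : ℕ) : Fin (2 * m + 1))) = antipodalMinor R m i :=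
  normMinor_cycleAdj R _ _ _ (leadingCoeff_antipodalMinor R lo hm i)

lemma normMinor_self (hm : 3 ≤ m) (i : Fin (2 * m + 1)) :
    normMinor R (gradedLex lo) (cycleAdj (2 * m + 1)) i (i + (m : Fin (2 * m + 1))) =
      antipodalMinor R m (i + (m : Fin (2 * m + 1))) := by
  rw [← cycleAdjugate_add_natCast]
  refine normMinor_cycleAdj R _ _ _ ?_
  rw [cycleAdjugate_add_natCast]
  exact leadingCoeff_antipodalMinor R lo hm _

lemma antipodalMinor_injective (hm : 3 ≤ m) : Function.Injective (antipodalMinor R m) := by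
  intro i j hij
  have lo : LinearOrder (Fin (2 * m + 1)) := inferInstance
  apply arc_injective (l := m) (by omega) (by omega)
  rw [← degree_antipodalMinor R lo hm i, ← degree_antipodalMinor R lo hm j, hij]

lemma isReducedGroebnerBasis_antipodalMinor (hm : 3 ≤ m) :
    IsReducedGroebnerBasis (gradedLex lo) (Set.range (antipodalMinor R m))
      (Ideal.span (Set.range (antipodalMinor R m))) where
  finite := Set.finite_range _
  zero_notMem := by
    rintro ⟨i, hi⟩
    have := leadingCoeff_antipodalMinor R lo hm i
    rw [hi, MonomialOrder.leadingCoeff_zero] at this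
    exact zero_ne_one this
  subset := Ideal.subset_span
  span_leadingTerm := by
    refine le_antisymm (Ideal.span_mono (Set.image_mono Ideal.subset_span)) (Ideal.span_le.2 ?_)
    rintro _ ⟨f, hf, rfl⟩
    by_cases h0 : f = 0
    · rw [h0, MonomialOrder.leadingTerm_zero]
      exact Ideal.zero_mem _
    · obtain ⟨i, hi⟩ := exists_arc_le R hm hf ((gradedLex lo).degree_mem_support h0)
        fun e he => degree_le_degree_gradedLex lo he
      have hB : (monomial (arc m i) 1 : MvPolynomial (Fin (2 * m + 1)) R) ∈
          Ideal.span ((gradedLex lo).leadingTerm '' Set.range (antipodalMinor R m)) := by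
        refine Ideal.subset_span ⟨_, ⟨i, rfl⟩, ?_⟩
        rw [MonomialOrder.leadingTerm, degree_antipodalMinor R lo hm,
          leadingCoeff_antipodalMinor R lo hm]
      have := Ideal.mul_mem_left _ (monomial ((gradedLex lo).degree f - arc m i)
        ((gradedLex lo).leadingCoeff f)) hB
      rw [monomial_mul, mul_one, tsub_add_cancel_of_le hi] at this
      exact this
  leadingCoeff_eq_one := by
    rintro _ ⟨i, rfl⟩
    exact leadingCoeff_antipodalMinor R lo hm i
  not_dvd := by
    classical
    rintro _ ⟨i, rfl⟩ _ ⟨j, rfl⟩ hne e he hdvd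
    have hcoeff := mem_support_iff.1 he
    have hle : arc m j ≤ e := by
      rw [degree_antipodalMinor R lo hm] at hdvd
      exact (monomial_dvd_monomial.1 hdvd).1.resolve_left hcoeff
    have hdeg : e.degree ≤ m :=
      Nat.lt_succ_iff.1 (mem_degreeLT.1 (antipodalMinor_mem R hm i) e hcoeff)
    -- All leading monomials have degree `m`, so divisibility forces equality; but the only term of
    -- degree `m` in the minor of `i` is `arc m i`.
    have hej : arc m j = e := by
      obtain ⟨b, rfl⟩ := exists_add_of_le hle
      rw [map_add, degree_arc] at hdeg
      rw [(Finsupp.degree_eq_zero_iff b).1 (by omega), add_zero]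
    have h1 := coeff_eq_zero_of_mem_degreeLT (antipodalMinor_sub_mem R hm i) (e := e)
      (by rw [← hej, degree_arc])
    rw [coeff_sub, coeff_monomial, sub_eq_zero] at h1
    rw [h1] at hcoeff
    split_ifs at hcoeff with h2
    · have := arc_injective (n := 2 * m + 1) (l := m) (by omega) (by omega) (h2.trans hej.symm)
      exact hne (by rw [this])
    · exact hcoeff rfl

end

end Groebner

end CriticalIdeals

theorem mainTheorem1 {R : Type*} [CommRing R] [Nontrivial R] (m : ℕ) (hn : 7 ≤ 2 * m + 1)
    (lo : LinearOrder (Fin (2 * m + 1))) :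
    let q : Fin (2 * m + 1) → Fin (2 * m + 1) → MvPolynomial (Fin (2 * m + 1)) R :=
      CriticalIdeals.normMinor R (CriticalIdeals.gradedLex lo)
        (CriticalIdeals.cycleAdj (2 * m + 1))
    let B : Set (MvPolynomial (Fin (2 * m + 1)) R) :=
      Set.range fun i => q i (i + Fin.ofNat (2 * m + 1) (m + 1))
    (Function.Injective fun i => q i (i + Fin.ofNat (2 * m + 1) (m + 1))) ∧
      B = (Set.range fun i => q i (i + Fin.ofNat (2 * m + 1) m)) ∧
      CriticalIdeals.IsReducedGroebnerBasis (CriticalIdeals.gradedLex lo) B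
        (CriticalIdeals.criticalIdeal R (CriticalIdeals.cycleAdj (2 * m + 1)) (2 * m)) := by
  have hm : 3 ≤ m := by omega
  intro q B
  have h1 : (fun i => q i (i + Fin.ofNat (2 * m + 1) (m + 1))) =
      CriticalIdeals.antipodalMinor R m :=
    funext fun i => CriticalIdeals.normMinor_succ R lo hm i
  -- The second family is the first one reindexed by the rotation through `m`, hence has the same
  -- range.
  have h2 : (fun i => q i (i + Fin.ofNat (2 * m + 1) m)) =
      CriticalIdeals.antipodalMinor R m ∘ Equiv.addRight (Fin.ofNat (2 * m + 1) m) :=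
    funext fun i => CriticalIdeals.normMinor_self R lo hm i
  have hB : B = Set.range (CriticalIdeals.antipodalMinor R m) := congrArg Set.range h1
  refine ⟨?_, ?_, ?_⟩
  · rw [h1]
    exact CriticalIdeals.antipodalMinor_injective R hm
  · rw [hB, h2, EquivLike.range_comp]
  · rw [hB, CriticalIdeals.criticalIdeal_eq_span R hm]
    exact CriticalIdeals.isReducedGroebnerBasis_antipodalMinor R lo hm
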